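/- Let $(M_*,g_*)$ be a non-empty smooth Riemannian manifold (without boundary) of dimension $n-1$, let $h,f:\mathbb{R}\to\mathbb{R}$ be smooth functions such that $h'(t)\neq 0$ for all $t$, and let $M=\mathbb{R}\times_{h'}M_*$ be the warped product, i.e. the $n$-dimensional manifold $\mathbb{R}\times M_*$ with the Riemannian metric $g=dt^2+h'(t)^2g_*$. Regard $f=f(t)$ as a function on $M$. Let $\mathrm{Ric}$, $S$, $\nabla^2f$ and $\Delta f$ denote the Ricci tensor, the scalar curvature, the Hessian of $f$ and the Laplacian of $f$ (the trace of the Hessian) with respect to $g$. Call $(M,g)$ with the potential $f$ a steady Ricci–Bourguignon gradient soliton if $$\mathrm{Ric}+\nabla^2 f-\frac{S}{n}\,g=0 .$$ For a real number $\lambda_*$ consider the equation $$(n-2)\big[h''^2-h'h'''\big]+h'\big[f''h'-f'h''\big]=\lambda_*\qquad\text{on }\mathbb{R}. \tag{1}$$ (a) Let $n\geq 4$. Then $M$ with the potential $f(t)$ is a steady Ricci–Bourguignon gradient soliton if and only if $f$ is harmonic on $M$ (that is, $\Delta f=0$) and there is a constant $\lambda_*$ such that $(M_*,g_*)$ is Einstein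 with $\mathrm{Ric}_*=\lambda_*g_*$ and equation (1) holds. (b) Let $n=3$ and suppose that $g_*$ is a metric of constant curvature $\lambda_*$. Then $M$ with the potential $f(t)$ is a steady Ricci–Bourguignon gradient soliton if and only if $f$ is harmonic on $M$ and equation (1) holds. -/

import Mathlib

open scoped Manifold ContDiff
open Bundle

/-! ### Riemannian geometry of a field of bilinear forms on a vector space

`G` is a field of symmetric nondegenerate bilinear forms on a finite-dimensional real vector space
`E`: the expression of a metric in a chart. -/

namespace LocalGeometry

/-- The Christoffel symbols of the Levi-Civita connection of `G`: `Γ_x(u, v)` is the vector with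
`G_x(Γ_x(u, v), w) = (D_u G(v, w) + D_v G(u, w) - D_w G(u, v)) / 2` for all `w`. -/
noncomputable def christoffel {E : Type*} [NormedAddCommGroup E] [NormedSpace ℝ E]
    (G : E → E →L[ℝ] E →L[ℝ] ℝ) (x u v : E) : E :=
  (G x).inverse ((1 / 2 : ℝ) •
    (fderiv ℝ (fun y ↦ G y v) x u + fderiv ℝ (fun y ↦ G y u) x v
      - fderiv ℝ (fun y ↦ G y u v) x))

/-- The Riemann curvature tensor `R(u, v)w = ∇_u ∇_v w - ∇_v ∇_u w`, computed with constant vector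
fields `u`, `v`, `w`. -/
noncomputable def curvature {E : Type*} [NormedAddCommGroup E] [NormedSpace ℝ E]
    (G : E → E →L[ℝ] E →L[ℝ] ℝ) (x u v w : E) : E :=
  fderiv ℝ (fun y ↦ christoffel G y v w) x u - fderiv ℝ (fun y ↦ christoffel G y u w) x v
    + christoffel G x u (christoffel G x v w) - christoffel G x v (christoffel G x u w)

/-- The Ricci tensor: `Ric(v, w)` is the trace of `u ↦ R(u, v)w`, computed in a basis. -/
noncomputable def ricci {E : Type*} [NormedAddCommGroup E] [NormedSpace ℝ E]
    [FiniteDimensional ℝ E] (G : E → E →L[ℝ] E →L[ℝ] ℝ) (x v w : E) : ℝ :=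
  ∑ i, (Module.finBasis ℝ E).coord i (curvature G x (Module.finBasis ℝ E i) v w)

/-- The covariant Hessian `∇²F(u, v) = D²F(u, v) - DF(Γ(u, v))`. -/
noncomputable def hessian {E : Type*} [NormedAddCommGroup E] [NormedSpace ℝ E]
    (G : E → E →L[ℝ] E →L[ℝ] ℝ) (F : E → ℝ) (x u v : E) : ℝ :=
  fderiv ℝ (fun y ↦ fderiv ℝ F y v) x u - fderiv ℝ F x (christoffel G x u v)

/-- The trace `∑ i j, B₀^{ij} B_{ij}` of a bilinear form `B` with respect to a scalar product `B₀`,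
computed in a basis. -/
noncomputable def metricTrace {E : Type*} [NormedAddCommGroup E] [NormedSpace ℝ E]
    [FiniteDimensional ℝ E] (B₀ B : E → E → ℝ) : ℝ :=
  ∑ i, ∑ j, (Matrix.of fun k l ↦ B₀ (Module.finBasis ℝ E k) (Module.finBasis ℝ E l))⁻¹ i j
    * B (Module.finBasis ℝ E i) (Module.finBasis ℝ E j)

end LocalGeometry

/-! ### Riemannian metrics on manifolds (without boundary) -/

/-- A smooth Riemannian metric on `M`. -/
abbrev SmoothMetric {E : Type*} [NormedAddCommGroup E] [NormedSpace ℝ E]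
    {H : Type*} [TopologicalSpace H] (I : ModelWithCorners ℝ E H)
    (M : Type*) [TopologicalSpace M] [ChartedSpace H M] [IsManifold I ∞ M] :=
  ContMDiffRiemannianMetric I ∞ E (TangentSpace I : M → Type _)

namespace SmoothMetric

section

variable {E : Type*} [NormedAddCommGroup E] [NormedSpace ℝ E]
  {H : Type*} [TopologicalSpace H] {I : ModelWithCorners ℝ E H}
  {M : Type*} [TopologicalSpace M] [ChartedSpace H M] [IsManifold I ∞ M]

/-- The metric in the preferred chart at `p`: the pullback of `g` by the inverse of the chart. -/
noncomputable def inChart (g : SmoothMetric I M) (p : M) (x : E) : E →L[ℝ] E →L[ℝ] ℝ :=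
  ContinuousLinearMap.bilinearComp (E := E) (F := E)
    (g.inner ((extChartAt I p).symm x))
    (mfderivWithin 𝓘(ℝ, E) I (extChartAt I p).symm (Set.range I) x)
    (mfderivWithin 𝓘(ℝ, E) I (extChartAt I p).symm (Set.range I) x)

/-- The tangent space at `p` is identified with `E` by the preferred chart at `p`; under this
identification the chart expression of the metric at `p` is the metric at `p`. -/
theorem inChart_self (g : SmoothMetric I M) (p : M) :
    g.inChart p (extChartAt I p p) = g.inner p := by
  unfold inChart
  rw [mfderivWithin_range_extChartAt_symm, extChartAt_to_inv]
  rfl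

/-- The Riemann curvature tensor `R(u, v)w` at `p`. -/
noncomputable def curvature (g : SmoothMetric I M) (p : M) (u v w : TangentSpace I p) :
    TangentSpace I p :=
  LocalGeometry.curvature (E := E) (g.inChart p) (extChartAt I p p) u v w

/-- The Hessian `∇²f` at `p`. -/
noncomputable def hessian (g : SmoothMetric I M) (f : M → ℝ) (p : M) (u v : TangentSpace I p) : ℝ :=
  LocalGeometry.hessian (E := E) (g.inChart p) (fun x ↦ f ((extChartAt I p).symm x))
    (extChartAt I p p) u v

/-- The metric has constant sectional curvature `κ`. -/
def HasConstantCurvature (g : SmoothMetric I M) (κ : ℝ) : Prop :=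
  ∀ (p : M) (u v : TangentSpace I p),
    g.inner p (g.curvature p u v v) u =
      κ * (g.inner p u u * g.inner p v v - g.inner p u v ^ 2)

variable [FiniteDimensional ℝ E]

/-- The Ricci tensor at `p`. -/
noncomputable def ricci (g : SmoothMetric I M) (p : M) (v w : TangentSpace I p) : ℝ :=
  LocalGeometry.ricci (E := E) (g.inChart p) (extChartAt I p p) v w

/-- The scalar curvature `S`, the trace of the Ricci tensor. -/
noncomputable def scalarCurvature (g : SmoothMetric I M) (p : M) : ℝ :=
  LocalGeometry.metricTrace (E := E) (fun u v ↦ g.inner p u v) (g.ricci p)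

/-- The Laplacian `Δf`, the trace of the Hessian. -/
noncomputable def laplacian (g : SmoothMetric I M) (f : M → ℝ) (p : M) : ℝ :=
  LocalGeometry.metricTrace (E := E) (fun u v ↦ g.inner p u v) (g.hessian f p)

/-- `f` is harmonic: `Δf = 0`. -/
def IsHarmonic (g : SmoothMetric I M) (f : M → ℝ) : Prop :=
  ∀ p, g.laplacian f p = 0

/-- The metric is Einstein with `Ric = lam • g`. -/
def IsEinstein (g : SmoothMetric I M) (lam : ℝ) : Prop :=
  ∀ (p : M) (u v : TangentSpace I p), g.ricci p u v = lam * g.inner p u v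

/-- Gradient Ricci-Bourguignon soliton with potential `f`: `Ric + ∇²f - ρ S g = lam g`. -/
def IsRicciBourguignonSoliton (g : SmoothMetric I M) (f : M → ℝ) (ρ lam : ℝ) : Prop :=
  ∀ (p : M) (u v : TangentSpace I p),
    g.ricci p u v + g.hessian f p u v - ρ * g.scalarCurvature p * g.inner p u v
      = lam * g.inner p u v

/-- Steady Ricci-Bourguignon gradient soliton: `Ric + ∇²f - (S / n) g = 0`, with `n = dim M`. -/
def IsSteadySoliton (g : SmoothMetric I M) (f : M → ℝ) : Prop :=
  g.IsRicciBourguignonSoliton f (1 / (Module.finrank ℝ E : ℝ)) 0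

end

/-! ### Warped products -/

section

variable {E : Type*} [NormedAddCommGroup E] [NormedSpace ℝ E]
  {H : Type*} [TopologicalSpace H] {I : ModelWithCorners ℝ E H}
  {N : Type*} [TopologicalSpace N] [ChartedSpace H N] [IsManifold I ∞ N]

/-- The bilinear form `dt² + φ(t)² g` on the tangent space of `ℝ × N` at `p = (t, q)`. -/
noncomputable def warpedForm (φ : ℝ → ℝ) (g : SmoothMetric I N) (p : ℝ × N) :
    TangentSpace (𝓘(ℝ, ℝ).prod I) p →L[ℝ] TangentSpace (𝓘(ℝ, ℝ).prod I) p →L[ℝ] ℝ :=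
  (ContinuousLinearMap.mul ℝ ℝ).bilinearComp
      (ContinuousLinearMap.fst ℝ ℝ E) (ContinuousLinearMap.fst ℝ ℝ E)
    + φ p.1 ^ 2 • ContinuousLinearMap.bilinearComp (E := E) (F := E) (g.inner p.2)
      (ContinuousLinearMap.snd ℝ ℝ E) (ContinuousLinearMap.snd ℝ ℝ E)

theorem warpedForm_apply (φ : ℝ → ℝ) (g : SmoothMetric I N) (p : ℝ × N)
    (u v : TangentSpace (𝓘(ℝ, ℝ).prod I) p) :
    warpedForm φ g p u v = u.1 * v.1 + φ p.1 ^ 2 * g.inner p.2 u.2 v.2 := rfl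

theorem symm_trivializationAt_prod {p q : ℝ × N} (hq : q ∈ (chartAt (ModelProd ℝ H) p).source) (v : ℝ × E) :
    (trivializationAt (ℝ × E) (TangentSpace (𝓘(ℝ, ℝ).prod I)) p).symm q v =
      (v.1, (trivializationAt E (TangentSpace I) p.2).symm q.2 v.2) := by
  have hq2 : q.2 ∈ (chartAt H p.2).source := by
    simp only [prodChartedSpace_chartAt] at hq
    exact hq.2
  rw [← Bundle.Trivialization.symmL_apply (R := ℝ) _ (by simpa using hq),
    ← Bundle.Trivialization.symmL_apply (R := ℝ) _ (by simpa using hq2),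
    TangentBundle.symmL_trivializationAt hq, TangentBundle.symmL_trivializationAt hq2,
    extChartAt_prod, ModelWithCorners.range_prod, PartialEquiv.prod_coe, PartialEquiv.prod_coe_symm]
  have hd : MDifferentiableWithinAt 𝓘(ℝ, E) I (extChartAt I p.2).symm (Set.range I)
      (extChartAt I p.2 q.2) :=
    mdifferentiableWithinAt_extChartAt_symm ((extChartAt I p.2).map_source (by simpa using hq2))
  have key := mfderivWithin_prodMap (I := 𝓘(ℝ, ℝ)) (J := 𝓘(ℝ, ℝ)) (I' := 𝓘(ℝ, E)) (J' := I)
    (p := (q.1, extChartAt I p.2 q.2)) (s := Set.univ)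
    (f := fun t : ℝ ↦ t) (g := (extChartAt I p.2).symm) mdifferentiableWithinAt_id hd
    (uniqueMDiffWithinAt_univ _) (I.uniqueDiffOn.uniqueMDiffOn _ ⟨_, rfl⟩)
  rw [mfderivWithin_univ] at key
  have h4 : mfderiv 𝓘(ℝ, ℝ) 𝓘(ℝ, ℝ) (fun t : ℝ ↦ t) q.1 = ContinuousLinearMap.id ℝ ℝ :=
    mfderiv_id
  rw [h4] at key
  have h5 := congrArg (fun A : (ℝ × E) →L[ℝ] (ℝ × E) ↦ A v) key
  rw [← modelWithCornersSelf_prod, chartedSpaceSelf_prod] at h5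
  have e1 : extChartAt 𝓘(ℝ, ℝ) p.1 = PartialEquiv.refl ℝ := extChartAt_model_space_eq_id ℝ p.1
  rw [e1, show Set.range 𝓘(ℝ, ℝ) = Set.univ from Set.range_id]
  exact h5

theorem contDiff_bilinearComp_snd :
    ContDiff ℝ ∞ (fun c : E →L[ℝ] E →L[ℝ] ℝ ↦
      c.bilinearComp (ContinuousLinearMap.snd ℝ ℝ E) (ContinuousLinearMap.snd ℝ ℝ E)) := by
  refine IsBoundedLinearMap.contDiff (IsLinearMap.with_bound ⟨fun _ _ ↦ rfl, fun _ _ ↦ rfl⟩ 1 ?_)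
  intro c
  refine ContinuousLinearMap.opNorm_le_bound₂ _ (by positivity) fun u v ↦ ?_
  simp only [ContinuousLinearMap.bilinearComp_apply, ContinuousLinearMap.coe_snd', one_mul]
  refine (c.le_opNorm₂ _ _).trans ?_
  gcongr
  · exact norm_snd_le u
  · exact norm_snd_le v

theorem warpedForm_contMDiff {φ : ℝ → ℝ} (hφ : ContDiff ℝ ∞ φ) (g : SmoothMetric I N)  :
    ContMDiff (𝓘(ℝ, ℝ).prod I) ((𝓘(ℝ, ℝ).prod I).prod 𝓘(ℝ, (ℝ × E) →L[ℝ] (ℝ × E) →L[ℝ] ℝ)) ∞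
      (fun p : ℝ × N ↦ TotalSpace.mk' ((ℝ × E) →L[ℝ] (ℝ × E) →L[ℝ] ℝ)
        (E := fun p : ℝ × N ↦ TangentSpace (𝓘(ℝ, ℝ).prod I) p →L[ℝ] TangentSpace (𝓘(ℝ, ℝ).prod I) p →L[ℝ] ℝ) p
        (warpedForm φ g p)) := by
  intro p
  rw [Bundle.contMDiffAt_section]
  have h1 := g.contMDiff p.2
  rw [Bundle.contMDiffAt_section] at h1
  simp only [hom_trivializationAt_apply] at h1 ⊢
  have h2 : ContMDiffAt (𝓘(ℝ, ℝ).prod I) 𝓘(ℝ, (ℝ × E) →L[ℝ] (ℝ × E) →L[ℝ] ℝ) ∞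
      (fun q : ℝ × N ↦ (ContinuousLinearMap.mul ℝ ℝ).bilinearComp
      (ContinuousLinearMap.fst ℝ ℝ E) (ContinuousLinearMap.fst ℝ ℝ E)
        + φ q.1 ^ 2 • ContinuousLinearMap.bilinearComp (E := E) (F := E)
          (ContinuousLinearMap.inCoordinates E (TangentSpace I) (E →L[ℝ] ℝ)
            (fun x : N ↦ TangentSpace I x →L[ℝ] ℝ) p.2 q.2 p.2 q.2 (g.inner q.2))
        (ContinuousLinearMap.snd ℝ ℝ E) (ContinuousLinearMap.snd ℝ ℝ E)) p := by
    have hC : ContMDiffAt (𝓘(ℝ, ℝ).prod I) 𝓘(ℝ, (ℝ × E) →L[ℝ] (ℝ × E) →L[ℝ] ℝ) ∞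
        (fun q : ℝ × N ↦ ContinuousLinearMap.bilinearComp (E := E) (F := E)
          (ContinuousLinearMap.inCoordinates E (TangentSpace I) (E →L[ℝ] ℝ)
            (fun x : N ↦ TangentSpace I x →L[ℝ] ℝ) p.2 q.2 p.2 q.2 (g.inner q.2))
          (ContinuousLinearMap.snd ℝ ℝ E) (ContinuousLinearMap.snd ℝ ℝ E)) p :=
      ContMDiffAt.comp p (g := fun c : E →L[ℝ] E →L[ℝ] ℝ ↦ c.bilinearComp
          (ContinuousLinearMap.snd ℝ ℝ E) (ContinuousLinearMap.snd ℝ ℝ E))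
        contDiff_bilinearComp_snd.contMDiff.contMDiffAt
        (ContMDiffAt.comp p h1 contMDiffAt_snd)
    have hφ' : ContMDiffAt (𝓘(ℝ, ℝ).prod I) 𝓘(ℝ, ℝ) ∞ (fun q : ℝ × N ↦ φ q.1 ^ 2) p :=
      ContMDiffAt.comp p (g := fun t ↦ φ t ^ 2) (hφ.pow 2).contMDiff.contMDiffAt contMDiffAt_fst
    exact contMDiffAt_const.add (hφ'.smul hC)
  refine h2.congr_of_eventuallyEq ?_
  filter_upwards [(chartAt (ModelProd ℝ H) p).open_source.mem_nhds (mem_chart_source _ p)] with q hq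
  have hq2 : q.2 ∈ (chartAt H p.2).source := by
    simp only [prodChartedSpace_chartAt] at hq
    exact hq.2
  refine ContinuousLinearMap.ext fun v ↦ ContinuousLinearMap.ext fun w ↦ ?_
  rw [inCoordinates_apply_eq₂ (by simpa using hq) (by simpa using hq) (Set.mem_univ _)]
  rw [symm_trivializationAt_prod hq, symm_trivializationAt_prod hq]
  have h3 := inCoordinates_apply_eq₂ (𝕜 := ℝ) (F₁ := E) (E₁ := (TangentSpace I : N → Type _))
    (F₂ := E) (E₂ := (TangentSpace I : N → Type _)) (F₃ := ℝ) (E₃ := Bundle.Trivial N ℝ)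
    (x₀ := p.2) (x := q.2) (ϕ := g.inner q.2) (v := v.2) (w := w.2)
    (by simpa using hq2) (by simpa using hq2) (Set.mem_univ _)
  have e1 : ∀ r : ℝ, (trivializationAt ℝ (Bundle.Trivial (ℝ × N) ℝ) p).linearMapAt ℝ q r = r := by
    intro r; simp
  have e2 : ∀ r : ℝ, (trivializationAt ℝ (Bundle.Trivial N ℝ) p.2).linearMapAt ℝ q.2 r = r := by
    intro r; simp
  refine (e1 _).trans ?_
  exact congrArg (fun r : ℝ ↦ v.1 * w.1 + φ q.1 ^ 2 * r) (h3.trans (e2 _)).symm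

theorem warpedForm_pos_aux (B : E →L[ℝ] E →L[ℝ] ℝ) (hB : ∀ w, w ≠ 0 → 0 < B w w) {c : ℝ}
    (hc : c ≠ 0) (v : ℝ × E) (hv : v ≠ 0) : 0 < v.1 * v.1 + c ^ 2 * B v.2 v.2 := by
  have h0 := sq_pos_of_ne_zero hc
  by_cases h2 : v.2 = 0
  · have h1 : v.1 ≠ 0 := fun h1 ↦ hv (Prod.ext h1 h2)
    have h3 := mul_self_pos.2 h1
    rw [h2, map_zero]
    linarith
  · have h3 := hB v.2 h2
    have h4 := mul_self_nonneg v.1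
    positivity

theorem warpedForm_bounded_aux (B : E →L[ℝ] E →L[ℝ] ℝ) (hB : ∀ w, w ≠ 0 → 0 < B w w)
    (hb : Bornology.IsVonNBounded ℝ {w : E | B w w < 1}) {c : ℝ} (hc : c ≠ 0) :
    Bornology.IsVonNBounded ℝ {v : ℝ × E | v.1 * v.1 + c ^ 2 * B v.2 v.2 < 1} := by
  rw [NormedSpace.isVonNBounded_iff, isBounded_iff_forall_norm_le] at hb ⊢
  obtain ⟨C, hC⟩ := hb
  refine ⟨max 1 (C / |c|), fun v hv ↦ ?_⟩
  have hv' : v.1 * v.1 + c ^ 2 * B v.2 v.2 < 1 := hv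
  have h0 : 0 < |c| := abs_pos.2 hc
  have hnn : 0 ≤ B v.2 v.2 := by
    by_cases h2 : v.2 = 0
    · rw [h2, map_zero]
    · exact (hB v.2 h2).le
  have hnn' : 0 ≤ c ^ 2 * B v.2 v.2 := mul_nonneg (sq_nonneg _) hnn
  refine max_le_max ?_ ?_
  · rw [Real.norm_eq_abs]
    exact abs_le_one_iff_mul_self_le_one.2 (by linarith)
  · rw [le_div_iff₀ h0, mul_comm, ← Real.norm_eq_abs, ← norm_smul]
    refine hC _ ?_
    have e : B (c • v.2) (c • v.2) = c ^ 2 * B v.2 v.2 := by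
      simp
      ring
    change B (c • v.2) (c • v.2) < 1
    rw [e]
    linarith [mul_self_nonneg v.1]

/-- The warped product metric `dt² + φ(t)² g` on `ℝ × N`. -/
noncomputable def warpedProduct (φ : ℝ → ℝ) (hφ : ContDiff ℝ ∞ φ) (hφ0 : ∀ t, φ t ≠ 0)
    (g : SmoothMetric I N) : SmoothMetric (𝓘(ℝ, ℝ).prod I) (ℝ × N) where
  inner := warpedForm φ g
  symm p u v := by
    have h1 := g.symm p.2 u.2 v.2
    exact congrArg₂ (fun a b : ℝ ↦ a + φ p.1 ^ 2 * b) (mul_comm u.1 v.1) h1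
  pos p v hv := warpedForm_pos_aux (E := E) (g.inner p.2) (g.pos p.2) (hφ0 p.1) v hv
  isVonNBounded p :=
    warpedForm_bounded_aux (E := E) (g.inner p.2) (g.pos p.2) (g.isVonNBounded p.2) (hφ0 p.1)
  contMDiff := warpedForm_contMDiff hφ g

end

end SmoothMetric

/-- The equation
`a (n - 2) (h₂² - h₁ h₃) + b h₁ (f₂ h₁ - f₁ h₂) = lam a`, a subscript denoting the order of the
derivative. -/
def WarpingEquation (n : ℕ) (a b : ℝ) (h f : ℝ → ℝ) (lam : ℝ) : Prop :=
  ∀ t : ℝ,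
    a * ((n : ℝ) - 2) * (iteratedDeriv 2 h t ^ 2 - deriv h t * iteratedDeriv 3 h t)
      + b * deriv h t * (iteratedDeriv 2 f t * deriv h t - deriv f t * iteratedDeriv 2 h t)
      = lam * a

open Filter Topology

namespace LocalGeometry

variable {E : Type*} [NormedAddCommGroup E] [NormedSpace ℝ E] {G : E → E →L[ℝ] E →L[ℝ] ℝ} {x : E}

/-- `G` is, near `x`, a field of scalar products which is twice continuously differentiable. -/
structure IsMetricAt (G : E → E →L[ℝ] E →L[ℝ] ℝ) (x : E) : Prop where
  contDiffAt : ContDiffAt ℝ 2 G x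
  symm : ∀ᶠ y in 𝓝 x, ∀ u v, G y u v = G y v u
  pos : ∀ᶠ y in 𝓝 x, ∀ u, u ≠ 0 → 0 < G y u u

/-- The derivative `D_u G(v, w)`. -/
noncomputable def metricDeriv (G : E → E →L[ℝ] E →L[ℝ] ℝ) (x u v w : E) : ℝ :=
  fderiv ℝ (fun y ↦ G y v w) x u

namespace IsMetricAt

theorem eventually (hG : IsMetricAt G x) : ∀ᶠ y in 𝓝 x, IsMetricAt G y := by
  filter_upwards [hG.contDiffAt.eventually (by simp), hG.symm.eventually_nhds,
    hG.pos.eventually_nhds] with y h1 h2 h3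
  exact ⟨h1, h2, h3⟩

theorem symm_self (hG : IsMetricAt G x) (u v : E) : G x u v = G x v u := hG.symm.self_of_nhds u v

theorem pos_self (hG : IsMetricAt G x) {u : E} (hu : u ≠ 0) : 0 < G x u u :=
  hG.pos.self_of_nhds u hu

theorem eq_of_forall_apply_eq (hG : IsMetricAt G x) {u v : E} (h : ∀ w, G x u w = G x v w) :
    u = v := by
  by_contra huv
  have := hG.pos_self (sub_ne_zero.2 huv)
  simp [h] at this

theorem contDiffAt_apply (hG : IsMetricAt G x) (v : E) : ContDiffAt ℝ 2 (fun y ↦ G y v) x :=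
  hG.contDiffAt.clm_apply contDiffAt_const

theorem contDiffAt_apply_apply (hG : IsMetricAt G x) (v w : E) :
    ContDiffAt ℝ 2 (fun y ↦ G y v w) x :=
  (hG.contDiffAt_apply v).clm_apply contDiffAt_const

theorem differentiableAt_apply (hG : IsMetricAt G x) (v : E) :
    DifferentiableAt ℝ (fun y ↦ G y v) x :=
  (hG.contDiffAt_apply v).differentiableAt (by simp)

theorem differentiableAt_apply_apply (hG : IsMetricAt G x) (v w : E) :
    DifferentiableAt ℝ (fun y ↦ G y v w) x :=
  (hG.contDiffAt_apply_apply v w).differentiableAt (by simp)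

theorem fderiv_apply (hG : IsMetricAt G x) (u v w : E) :
    fderiv ℝ (fun y ↦ G y v) x u w = metricDeriv G x u v w := by
  rw [metricDeriv, fderiv_clm_apply (c := fun y ↦ G y v) (hG.differentiableAt_apply v)
    (differentiableAt_const w)]
  simp

theorem metricDeriv_symm (hG : IsMetricAt G x) (u v w : E) :
    metricDeriv G x u v w = metricDeriv G x u w v := by
  unfold metricDeriv
  congr 1
  apply EventuallyEq.fderiv_eq
  filter_upwards [hG.symm] with y hy using hy v w

theorem metricDeriv_add_left (u u' v w : E) :
    metricDeriv G x (u + u') v w = metricDeriv G x u v w + metricDeriv G x u' v w :=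
  map_add _ _ _

theorem metricDeriv_smul_left (a : ℝ) (u v w : E) :
    metricDeriv G x (a • u) v w = a * metricDeriv G x u v w :=
  map_smul _ _ _

theorem metricDeriv_add_right (hG : IsMetricAt G x) (u v w w' : E) :
    metricDeriv G x u v (w + w') = metricDeriv G x u v w + metricDeriv G x u v w' := by
  simp only [← hG.fderiv_apply, map_add]

theorem metricDeriv_smul_right (hG : IsMetricAt G x) (u v : E) (a : ℝ) (w : E) :
    metricDeriv G x u v (a • w) = a * metricDeriv G x u v w := by
  simp only [← hG.fderiv_apply, map_smul, smul_eq_mul]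

theorem metricDeriv_add_mid (hG : IsMetricAt G x) (u v v' w : E) :
    metricDeriv G x u (v + v') w = metricDeriv G x u v w + metricDeriv G x u v' w := by
  simp only [hG.metricDeriv_symm u _ w, hG.metricDeriv_add_right]

theorem metricDeriv_smul_mid (hG : IsMetricAt G x) (u : E) (a : ℝ) (v w : E) :
    metricDeriv G x u (a • v) w = a * metricDeriv G x u v w := by
  simp only [hG.metricDeriv_symm u _ w, hG.metricDeriv_smul_right]

theorem fderiv_apply_comp (hG : IsMetricAt G x) {c : E → E} (hc : DifferentiableAt ℝ c x)
    (u w : E) :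
    fderiv ℝ (fun y ↦ G y (c y) w) x u = metricDeriv G x u (c x) w + G x (fderiv ℝ c x u) w := by
  have h : (fun y ↦ G y (c y) w) =ᶠ[𝓝 x] fun y ↦ G y w (c y) := by
    filter_upwards [hG.symm] with y hy using hy _ _
  rw [h.fderiv_eq, fderiv_clm_apply (c := fun y ↦ G y w) (hG.differentiableAt_apply w) hc,
    hG.metricDeriv_symm, hG.symm_self _ w, ← hG.fderiv_apply]
  simp only [add_apply, ContinuousLinearMap.comp_apply, ContinuousLinearMap.flip_apply]
  ring

theorem curvature_swap (u v w : E) : curvature G x u v w = -curvature G x v u w := by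
  simp only [curvature]
  abel

variable [FiniteDimensional ℝ E]

/-- The isomorphism of `E` with its dual given by the scalar product at `x`. -/
noncomputable def equivDual (hG : IsMetricAt G x) : E ≃L[ℝ] (E →L[ℝ] ℝ) :=
  (LinearEquiv.ofInjectiveOfFinrankEq (G x : E →ₗ[ℝ] E →L[ℝ] ℝ)
    (fun _ _ h ↦ hG.eq_of_forall_apply_eq fun w ↦ congrArg (fun A : E →L[ℝ] ℝ ↦ A w) h)
    (by rw [← (LinearMap.toContinuousLinearMap : (E →ₗ[ℝ] ℝ) ≃ₗ[ℝ] _).finrank_eq]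
        exact Subspace.dual_finrank_eq.symm)).toContinuousLinearEquiv

theorem coe_equivDual (hG : IsMetricAt G x) : (hG.equivDual : E →L[ℝ] E →L[ℝ] ℝ) = G x := rfl

theorem apply_inverse (hG : IsMetricAt G x) (a : E →L[ℝ] ℝ) : G x ((G x).inverse a) = a := by
  rw [← hG.coe_equivDual, ContinuousLinearMap.inverse_equiv]
  exact hG.equivDual.apply_symm_apply a

theorem contDiffAt_inverse (hG : IsMetricAt G x) :
    ContDiffAt ℝ 2 (fun y ↦ (G y).inverse) x := by
  have h := contDiffAt_map_inverse (n := 2) hG.equivDual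
  rw [hG.coe_equivDual] at h
  exact h.comp x hG.contDiffAt

theorem metric_christoffel (hG : IsMetricAt G x) (u v w : E) :
    G x (christoffel G x u v) w =
      1 / 2 * (metricDeriv G x u v w + metricDeriv G x v u w - metricDeriv G x w u v) := by
  rw [christoffel, hG.apply_inverse]
  simp only [smul_apply, add_apply,
    sub_apply, smul_eq_mul, hG.fderiv_apply]
  rfl

theorem christoffel_eq (hG : IsMetricAt G x) {u v c : E}
    (h : ∀ w, G x c w = 1 / 2 * (metricDeriv G x u v w + metricDeriv G x v u w - metricDeriv G x w u v)) :
    christoffel G x u v = c :=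
  hG.eq_of_forall_apply_eq fun w ↦ by rw [hG.metric_christoffel, h]

theorem christoffel_symm (hG : IsMetricAt G x) (u v : E) :
    christoffel G x u v = christoffel G x v u :=
  hG.christoffel_eq fun w ↦ by
    rw [hG.metric_christoffel, hG.metricDeriv_symm w u v]
    ring

theorem christoffel_add_right (hG : IsMetricAt G x) (u v v' : E) :
    christoffel G x u (v + v') = christoffel G x u v + christoffel G x u v' :=
  hG.christoffel_eq fun w ↦ by
    simp only [map_add, add_apply, hG.metric_christoffel, hG.metricDeriv_add_mid,
      hG.metricDeriv_add_right, metricDeriv_add_left]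
    ring

theorem christoffel_smul_right (hG : IsMetricAt G x) (u : E) (a : ℝ) (v : E) :
    christoffel G x u (a • v) = a • christoffel G x u v :=
  hG.christoffel_eq fun w ↦ by
    simp only [map_smul, smul_apply, hG.metric_christoffel, smul_eq_mul, hG.metricDeriv_smul_mid,
      hG.metricDeriv_smul_right, metricDeriv_smul_left]
    ring

theorem christoffel_add_left (hG : IsMetricAt G x) (u u' v : E) :
    christoffel G x (u + u') v = christoffel G x u v + christoffel G x u' v := by
  rw [hG.christoffel_symm, hG.christoffel_add_right, hG.christoffel_symm v, hG.christoffel_symm v]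

theorem christoffel_smul_left (hG : IsMetricAt G x) (a : ℝ) (u v : E) :
    christoffel G x (a • u) v = a • christoffel G x u v := by
  rw [hG.christoffel_symm, hG.christoffel_smul_right, hG.christoffel_symm v]

/-- The Levi-Civita connection is metric. -/
theorem metricDeriv_eq (hG : IsMetricAt G x) (u v w : E) :
    metricDeriv G x u v w = G x (christoffel G x u v) w + G x v (christoffel G x u w) := by
  rw [hG.symm_self v, hG.metric_christoffel, hG.metric_christoffel, hG.metricDeriv_symm u w v,
    hG.metricDeriv_symm v u w, hG.metricDeriv_symm w u v]
  ring

theorem differentiableAt_christoffel (hG : IsMetricAt G x) (u v : E) :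
    DifferentiableAt ℝ (fun y ↦ christoffel G y u v) x := by
  have h1 : ∀ u v : E, DifferentiableAt ℝ (fun y ↦ fderiv ℝ (fun z ↦ G z v) y u) x := fun u v ↦
    (((hG.contDiffAt_apply v).fderiv_right (m := 1) (by norm_num)).differentiableAt
      (by simp)).clm_apply (differentiableAt_const u)
  have h2 : DifferentiableAt ℝ (fun y ↦ fderiv ℝ (fun z ↦ G z u v) y) x :=
    ((hG.contDiffAt_apply_apply u v).fderiv_right (m := 1) (by norm_num)).differentiableAt (by simp)
  exact (hG.contDiffAt_inverse.differentiableAt (by simp)).clm_apply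
    ((((h1 u v).add (h1 v u)).sub h2).const_smul (1 / 2 : ℝ))

theorem curvature_add_left (hG : IsMetricAt G x) (u u' v w : E) :
    curvature G x (u + u') v w = curvature G x u v w + curvature G x u' v w := by
  have h : fderiv ℝ (fun y ↦ christoffel G y (u + u') w) x =
      fderiv ℝ (fun y ↦ christoffel G y u w) x + fderiv ℝ (fun y ↦ christoffel G y u' w) x := by
    rw [← fderiv_add (hG.differentiableAt_christoffel u w) (hG.differentiableAt_christoffel u' w)]
    apply EventuallyEq.fderiv_eq
    filter_upwards [hG.eventually] with y hy using hy.christoffel_add_left u u' w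
  simp only [curvature, h, hG.christoffel_add_left, hG.christoffel_add_right, map_add,
    add_apply]
  abel

theorem curvature_smul_left (hG : IsMetricAt G x) (a : ℝ) (u v w : E) :
    curvature G x (a • u) v w = a • curvature G x u v w := by
  have h : fderiv ℝ (fun y ↦ christoffel G y (a • u) w) x =
      a • fderiv ℝ (fun y ↦ christoffel G y u w) x := by
    rw [← fderiv_const_smul (hG.differentiableAt_christoffel u w)]
    apply EventuallyEq.fderiv_eq
    filter_upwards [hG.eventually] with y hy using hy.christoffel_smul_left a u w
  simp only [curvature, h, hG.christoffel_smul_left, hG.christoffel_smul_right, map_smul,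
    smul_apply, smul_sub, smul_add]

theorem curvature_add_mid (hG : IsMetricAt G x) (u v v' w : E) :
    curvature G x u (v + v') w = curvature G x u v w + curvature G x u v' w := by
  rw [curvature_swap, hG.curvature_add_left, curvature_swap v, curvature_swap v']
  abel

theorem curvature_add_right (hG : IsMetricAt G x) (u v w w' : E) :
    curvature G x u v (w + w') = curvature G x u v w + curvature G x u v w' := by
  have h : ∀ v, fderiv ℝ (fun y ↦ christoffel G y v (w + w')) x =
      fderiv ℝ (fun y ↦ christoffel G y v w) x + fderiv ℝ (fun y ↦ christoffel G y v w') x := by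
    intro v
    rw [← fderiv_add (hG.differentiableAt_christoffel v w) (hG.differentiableAt_christoffel v w')]
    apply EventuallyEq.fderiv_eq
    filter_upwards [hG.eventually] with y hy using hy.christoffel_add_right v w w'
  simp only [curvature, h, hG.christoffel_add_right, add_apply]
  abel

theorem fderiv_christoffel_symm (hG : IsMetricAt G x) (u v : E) :
    fderiv ℝ (fun y ↦ christoffel G y u v) x = fderiv ℝ (fun y ↦ christoffel G y v u) x := by
  apply EventuallyEq.fderiv_eq
  filter_upwards [hG.eventually] with y hy using hy.christoffel_symm u v

/-- The first Bianchi identity. -/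
theorem bianchi (hG : IsMetricAt G x) (u v w : E) :
    curvature G x u v w + curvature G x v w u + curvature G x w u v = 0 := by
  simp only [curvature]
  rw [hG.fderiv_christoffel_symm w u, hG.fderiv_christoffel_symm v u,
    hG.fderiv_christoffel_symm w v, hG.christoffel_symm w u, hG.christoffel_symm v u,
    hG.christoffel_symm w v]
  abel

/-- The curvature operators are skew-adjoint. -/
theorem metric_curvature_self (hG : IsMetricAt G x) (u v w : E) :
    G x (curvature G x u v w) w = 0 := by
  have key : ∀ u v : E, fderiv ℝ (fderiv ℝ (fun y ↦ G y w w)) x u v =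
      2 * (G x (fderiv ℝ (fun y ↦ christoffel G y v w) x u) w
        + G x (christoffel G x u (christoffel G x v w)) w
        + G x (christoffel G x v w) (christoffel G x u w)) := by
    intro u v
    have hd : DifferentiableAt ℝ (fderiv ℝ (fun y ↦ G y w w)) x :=
      ((hG.contDiffAt_apply_apply w w).fderiv_right (m := 1) (by norm_num)).differentiableAt
        (by simp)
    have e1 : fderiv ℝ (fun y ↦ fderiv ℝ (fun y ↦ G y w w) y v) x u =
        fderiv ℝ (fderiv ℝ (fun y ↦ G y w w)) x u v := by
      rw [fderiv_clm_apply hd (differentiableAt_const v)]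
      simp
    have e2 : fderiv ℝ (fun y ↦ fderiv ℝ (fun y ↦ G y w w) y v) x =
        fderiv ℝ (fun y ↦ 2 * G y (christoffel G y v w) w) x := by
      apply EventuallyEq.fderiv_eq
      filter_upwards [hG.eventually] with y hy
      refine (hy.metricDeriv_eq v w w).trans ?_
      rw [hy.symm_self w]
      ring
    have hc := hG.differentiableAt_christoffel v w
    have hd2 : DifferentiableAt ℝ (fun y ↦ G y (christoffel G y v w) w) x :=
      (hG.contDiffAt.differentiableAt (by simp) |>.clm_apply hc).clm_apply (differentiableAt_const w)
    rw [← e1, e2, fderiv_const_mul hd2, smul_apply, hG.fderiv_apply_comp hc, hG.metricDeriv_eq,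
      smul_eq_mul]
    ring
  have hs : fderiv ℝ (fderiv ℝ (fun y ↦ G y w w)) x u v =
      fderiv ℝ (fderiv ℝ (fun y ↦ G y w w)) x v u :=
    (hG.contDiffAt_apply_apply w w).isSymmSndFDerivAt (by simp) u v
  have h1 := key u v
  rw [hs, key v u, hG.symm_self (christoffel G x u w)] at h1
  simp only [curvature, map_add, map_sub, add_apply,
    sub_apply]
  linarith

/-- The linear map `u ↦ R(u, v)w`. -/
noncomputable def curvatureMap (hG : IsMetricAt G x) (v w : E) : E →ₗ[ℝ] E where
  toFun u := curvature G x u v w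
  map_add' u u' := hG.curvature_add_left u u' v w
  map_smul' a u := hG.curvature_smul_left a u v w

theorem curvatureMap_apply (hG : IsMetricAt G x) (u v w : E) :
    hG.curvatureMap v w u = curvature G x u v w := rfl

end IsMetricAt

theorem sum_coord_eq_trace [FiniteDimensional ℝ E] (A : E →ₗ[ℝ] E) :
    ∑ i, (Module.finBasis ℝ E).coord i (A (Module.finBasis ℝ E i)) = LinearMap.trace ℝ E A := by
  rw [LinearMap.trace_eq_matrix_trace ℝ (Module.finBasis ℝ E)]
  simp [Matrix.trace, LinearMap.toMatrix_apply]

namespace IsMetricAt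

variable [FiniteDimensional ℝ E]

theorem ricci_eq_trace (hG : IsMetricAt G x) (v w : E) :
    ricci G x v w = LinearMap.trace ℝ E (hG.curvatureMap v w) :=
  sum_coord_eq_trace (hG.curvatureMap v w)

/-- An endomorphism which is skew-adjoint for a scalar product has trace zero. -/
theorem trace_eq_zero (hG : IsMetricAt G x) (A : E →ₗ[ℝ] E) (hA : ∀ u, G x (A u) u = 0) :
    LinearMap.trace ℝ E A = 0 := by
  have hA' : ∀ u v, G x (A u) v = -G x u (A v) := by
    intro u v
    have h := hA (u + v)
    simp only [map_add, add_apply, hA] at h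
    rw [hG.symm_self u]
    linarith
  let e : E ≃ₗ[ℝ] Module.Dual ℝ E :=
    hG.equivDual.toLinearEquiv.trans LinearMap.toContinuousLinearMap.symm
  have he : ∀ u v, e u v = G x u v := fun _ _ ↦ rfl
  have h : e.conj A = -Module.Dual.transpose (R := ℝ) A := by
    refine LinearMap.ext fun a ↦ ?_
    obtain ⟨u, rfl⟩ := e.surjective a
    refine LinearMap.ext fun v ↦ ?_
    rw [LinearEquiv.conj_apply_apply, e.symm_apply_apply, he, hA']
    rfl
  have h2 := LinearMap.trace_conj' A e
  have h3 := LinearMap.congr_fun (LinearMap.trace_transpose ℝ E) A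
  simp only [LinearMap.comp_apply] at h3
  rw [h, ← neg_one_smul ℝ (Module.Dual.transpose A), map_smul, h3, neg_one_smul] at h2
  linarith

theorem ricci_symm (hG : IsMetricAt G x) (v w : E) : ricci G x v w = ricci G x w v := by
  have h : LinearMap.trace ℝ E (hG.curvatureMap v w - hG.curvatureMap w v) = 0 := by
    apply hG.trace_eq_zero
    intro u
    have e : (hG.curvatureMap v w - hG.curvatureMap w v) u = -curvature G x v w u := by
      have hb := hG.bianchi u v w
      rw [curvature_swap w u v] at hb
      rw [LinearMap.sub_apply, hG.curvatureMap_apply, hG.curvatureMap_apply, eq_neg_iff_add_eq_zero,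
        ← hb]
      abel
    rw [e]
    simp [hG.metric_curvature_self]
  rw [map_sub, ← hG.ricci_eq_trace, ← hG.ricci_eq_trace] at h
  linarith

/-- A metric of constant curvature is Einstein. -/
theorem ricci_of_constantCurvature (hG : IsMetricAt G x) {κ : ℝ}
    (h : ∀ u v, G x (curvature G x u v v) u = κ * (G x u u * G x v v - G x u v ^ 2)) (v w : E) :
    ricci G x v w = κ * (Module.finrank ℝ E - 1) * G x v w := by
  have hd : ∀ v, ricci G x v v = κ * (Module.finrank ℝ E - 1) * G x v v := by
    intro v
    have ht : LinearMap.trace ℝ E (hG.curvatureMap v v - κ • (G x v v • LinearMap.id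
        - (G x v : E →ₗ[ℝ] ℝ).smulRight v)) = 0 := by
      apply hG.trace_eq_zero
      intro u
      simp only [LinearMap.sub_apply, LinearMap.smul_apply, LinearMap.id_apply,
        LinearMap.smulRight_apply, hG.curvatureMap_apply, map_sub, map_smul,
        sub_apply, smul_apply, smul_eq_mul, h,
        ContinuousLinearMap.coe_coe]
      rw [hG.symm_self v u]
      ring
    rw [map_sub, ← hG.ricci_eq_trace, map_smul, map_sub, map_smul, LinearMap.trace_smulRight,
      LinearMap.trace_id] at ht
    simp only [smul_eq_mul, ContinuousLinearMap.coe_coe] at ht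
    linarith
  have hadd : ricci G x (v + w) (v + w) =
      ricci G x v v + ricci G x w w + 2 * ricci G x v w := by
    have hm : hG.curvatureMap (v + w) (v + w) = hG.curvatureMap v v + hG.curvatureMap w w +
        (hG.curvatureMap v w + hG.curvatureMap w v) := by
      refine LinearMap.ext fun u ↦ ?_
      simp only [hG.curvatureMap_apply, LinearMap.add_apply, hG.curvature_add_mid,
        hG.curvature_add_right]
      abel
    rw [two_mul]
    nth_rw 2 [hG.ricci_symm v w]
    simp only [hG.ricci_eq_trace, hm, map_add]
  rw [hd, hd, hd] at hadd
  simp only [map_add, add_apply] at hadd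
  rw [hG.symm_self w v] at hadd
  linarith

end IsMetricAt

end LocalGeometry

namespace LocalGeometry

section Warped

variable {E : Type*} [NormedAddCommGroup E] [NormedSpace ℝ E] {G : E → E →L[ℝ] E →L[ℝ] ℝ}
  {φ : ℝ → ℝ} {z : ℝ × E}

/-- The field of bilinear forms `dt² + φ(t)² G` on `ℝ × E`. -/
noncomputable def warped (φ : ℝ → ℝ) (G : E → E →L[ℝ] E →L[ℝ] ℝ) (z : ℝ × E) :
    ℝ × E →L[ℝ] ℝ × E →L[ℝ] ℝ :=
  (ContinuousLinearMap.mul ℝ ℝ).bilinearComp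
      (ContinuousLinearMap.fst ℝ ℝ E) (ContinuousLinearMap.fst ℝ ℝ E)
    + φ z.1 ^ 2 • (G z.2).bilinearComp (ContinuousLinearMap.snd ℝ ℝ E)
      (ContinuousLinearMap.snd ℝ ℝ E)

theorem warped_apply (z u v : ℝ × E) :
    warped φ G z u v = u.1 * v.1 + φ z.1 ^ 2 * G z.2 u.2 v.2 := rfl

theorem contDiffAt_real_smul {F F' : Type*} [NormedAddCommGroup F] [NormedSpace ℝ F]
    [NormedAddCommGroup F'] [NormedSpace ℝ F'] {n : WithTop ℕ∞} {c : F → ℝ} {k : F → F'} {x : F}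
    (hc : ContDiffAt ℝ n c x) (hk : ContDiffAt ℝ n k x) : ContDiffAt ℝ n (fun y ↦ c y • k y) x :=
  hc.smul hk

theorem isMetricAt_warped (hφ : ContDiff ℝ ∞ φ) (hφ0 : ∀ t, φ t ≠ 0) (hG : IsMetricAt G z.2) :
    IsMetricAt (warped φ G) z where
  contDiffAt := by
    have h1 : ContDiffAt ℝ 2 (fun z : ℝ × E ↦ φ z.1 ^ 2) z :=
      (((hφ.pow 2).of_le ENat.LEInfty.out).comp contDiff_fst).contDiffAt
    have h2 : ContDiffAt ℝ 2 (fun z : ℝ × E ↦ (G z.2).bilinearComp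
        (ContinuousLinearMap.snd ℝ ℝ E) (ContinuousLinearMap.snd ℝ ℝ E)) z :=
      (SmoothMetric.contDiff_bilinearComp_snd.of_le ENat.LEInfty.out).contDiffAt.comp z
        (hG.contDiffAt.comp z contDiffAt_snd)
    exact contDiffAt_const.add (contDiffAt_real_smul h1 h2)
  symm := by
    filter_upwards [continuous_snd.continuousAt.eventually hG.symm] with y hy u v
    rw [warped_apply, warped_apply, hy, mul_comm u.1]
  pos := by
    filter_upwards [continuous_snd.continuousAt.eventually hG.pos] with y hy u hu
    exact SmoothMetric.warpedForm_pos_aux (G y.2) hy (hφ0 y.1) u hu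

theorem metricDeriv_warped (hφ : Differentiable ℝ φ) (hG : IsMetricAt G z.2) (u v w : ℝ × E) :
    metricDeriv (warped φ G) z u v w =
      2 * φ z.1 * deriv φ z.1 * u.1 * G z.2 v.2 w.2
        + φ z.1 ^ 2 * metricDeriv G z.2 u.2 v.2 w.2 := by
  have h1 : HasFDerivAt (fun y : ℝ × E ↦ φ y.1 ^ 2)
      ((2 * φ z.1 * deriv φ z.1) • ContinuousLinearMap.fst ℝ ℝ E) z := by
    have h : HasFDerivAt (fun y : ℝ × E ↦ φ y.1 ^ 2) _ z := ((hφ z.1).hasDerivAt.fun_pow 2).comp_hasFDerivAt z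
      (hasFDerivAt_fst (𝕜 := ℝ) (E := ℝ) (F := E) (p := z))
    simpa using h
  have h2 : HasFDerivAt (fun y : ℝ × E ↦ G y.2 v.2 w.2) _ z :=
    (hG.differentiableAt_apply_apply v.2 w.2).hasFDerivAt.comp z hasFDerivAt_snd
  have h := ((h1.fun_mul h2).const_add (v.1 * w.1)).fderiv
  have e : (fun y ↦ warped φ G y v w) = fun y ↦ v.1 * w.1 + φ y.1 ^ 2 * G y.2 v.2 w.2 := rfl
  simp only [metricDeriv, e, h, add_apply, smul_apply, ContinuousLinearMap.comp_apply,
    ContinuousLinearMap.coe_fst', ContinuousLinearMap.coe_snd', smul_eq_mul]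
  ring

variable [FiniteDimensional ℝ E]

theorem christoffel_warped (hφ : ContDiff ℝ ∞ φ) (hφ0 : ∀ t, φ t ≠ 0) (hG : IsMetricAt G z.2)
    (u v : ℝ × E) :
    christoffel (warped φ G) z u v =
      (-(φ z.1 * deriv φ z.1) * G z.2 u.2 v.2,
        christoffel G z.2 u.2 v.2 + (deriv φ z.1 / φ z.1) • (u.1 • v.2 + v.1 • u.2)) := by
  have hd : Differentiable ℝ φ := hφ.differentiable (by simp)
  refine (isMetricAt_warped hφ hφ0 hG).christoffel_eq fun w ↦ ?_
  simp only [metricDeriv_warped hd hG, warped_apply, map_add, add_apply, map_smul, smul_apply,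
    hG.metric_christoffel, smul_eq_mul]
  have := hφ0 z.1
  field_simp
  ring

theorem fderiv_christoffel_warped (hφ : ContDiff ℝ ∞ φ) (hφ0 : ∀ t, φ t ≠ 0)
    (hG : IsMetricAt G z.2) (u v w : ℝ × E) :
    fderiv ℝ (fun y ↦ christoffel (warped φ G) y v w) z u =
      (-(deriv φ z.1 ^ 2 + φ z.1 * deriv (deriv φ) z.1) * u.1 * G z.2 v.2 w.2
          - φ z.1 * deriv φ z.1 * metricDeriv G z.2 u.2 v.2 w.2,
        fderiv ℝ (fun y ↦ christoffel G y v.2 w.2) z.2 u.2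
          + ((deriv (deriv φ) z.1 / φ z.1 - (deriv φ z.1 / φ z.1) ^ 2) * u.1) •
            (v.1 • w.2 + w.1 • v.2)) := by
  have hd : Differentiable ℝ φ := hφ.differentiable (by simp)
  have hd' : Differentiable ℝ (deriv φ) :=
    ((contDiff_infty_iff_deriv.1 hφ).2).differentiable (by simp)
  have e : (fun y ↦ christoffel (warped φ G) y v w) =ᶠ[𝓝 z] fun y ↦
      (-(φ y.1 * deriv φ y.1) * G y.2 v.2 w.2,
        christoffel G y.2 v.2 w.2 + (deriv φ y.1 / φ y.1) • (v.1 • w.2 + w.1 • v.2)) := by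
    filter_upwards [continuous_snd.continuousAt.eventually hG.eventually] with y hy
    exact christoffel_warped hφ hφ0 hy v w
  have hfst : HasFDerivAt (fun y : ℝ × E ↦ y.1) (ContinuousLinearMap.fst ℝ ℝ E) z := hasFDerivAt_fst
  have hsnd : HasFDerivAt (fun y : ℝ × E ↦ y.2) (ContinuousLinearMap.snd ℝ ℝ E) z := hasFDerivAt_snd
  have h1 := ((hd z.1).hasDerivAt.fun_mul (hd' z.1).hasDerivAt).fun_neg.comp_hasFDerivAt z hfst
  have h2 : HasFDerivAt (fun y : ℝ × E ↦ G y.2 v.2 w.2) _ z :=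
    (hG.differentiableAt_apply_apply v.2 w.2).hasFDerivAt.comp z hsnd
  have h3 := ((hd' z.1).hasDerivAt.fun_div (hd z.1).hasDerivAt (hφ0 z.1)).comp_hasFDerivAt z hfst
  have h4 : HasFDerivAt (fun y : ℝ × E ↦ christoffel G y.2 v.2 w.2) _ z :=
    (hG.differentiableAt_christoffel v.2 w.2).hasFDerivAt.comp z hsnd
  have h := ((h1.mul h2).prodMk (h4.add (h3.smul_const (v.1 • w.2 + w.1 • v.2)))).fderiv
  rw [e.fderiv_eq]
  refine (congrArg (fun A : ℝ × E →L[ℝ] ℝ × E ↦ A u) h).trans (Prod.ext ?_ ?_)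
  · simp only [ContinuousLinearMap.prod_apply, add_apply, smul_apply,
      ContinuousLinearMap.comp_apply, ContinuousLinearMap.coe_fst', ContinuousLinearMap.coe_snd',
      smul_eq_mul, Function.comp_apply, metricDeriv]
    ring
  · simp only [ContinuousLinearMap.prod_apply, add_apply, smul_apply,
      ContinuousLinearMap.comp_apply, ContinuousLinearMap.coe_fst', ContinuousLinearMap.coe_snd',
      smul_eq_mul, ContinuousLinearMap.smulRight_apply]
    congr 2
    have := hφ0 z.1
    field_simp

theorem curvature_warped (hφ : ContDiff ℝ ∞ φ) (hφ0 : ∀ t, φ t ≠ 0) (hG : IsMetricAt G z.2)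
    (u v w : ℝ × E) :
    curvature (warped φ G) z u v w =
      (-(φ z.1 * deriv (deriv φ) z.1) * (u.1 * G z.2 v.2 w.2 - v.1 * G z.2 u.2 w.2),
        curvature G z.2 u.2 v.2 w.2
          + (deriv (deriv φ) z.1 / φ z.1 * w.1) • (u.1 • v.2 - v.1 • u.2)
          - deriv φ z.1 ^ 2 • (G z.2 v.2 w.2 • u.2 - G z.2 u.2 w.2 • v.2)) := by
  have h0 := hφ0 z.1
  simp only [curvature, fderiv_christoffel_warped hφ hφ0 hG, christoffel_warped hφ hφ0 hG]
  refine Prod.ext ?_ ?_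
  · simp only [Prod.fst_add, Prod.fst_sub, map_add, map_smul, hG.metricDeriv_eq, smul_eq_mul]
    rw [hG.symm_self v.2 u.2, hG.symm_self (christoffel G z.2 u.2 v.2),
      hG.symm_self (christoffel G z.2 v.2 u.2), hG.christoffel_symm v.2 u.2]
    field_simp
    ring
  · simp only [Prod.snd_add, Prod.snd_sub, hG.christoffel_add_right, hG.christoffel_smul_right]
    rw [hG.christoffel_symm v.2 u.2]
    match_scalars <;> field_simp <;> ring

end Warped

end LocalGeometry

namespace LocalGeometry

section Congr

variable {E : Type*} [NormedAddCommGroup E] [NormedSpace ℝ E] {G G' : E → E →L[ℝ] E →L[ℝ] ℝ} {x : E}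

theorem christoffel_congr (h : G =ᶠ[𝓝 x] G') (u v : E) :
    christoffel G x u v = christoffel G' x u v := by
  have h1 : ∀ v, fderiv ℝ (fun y ↦ G y v) x = fderiv ℝ (fun y ↦ G' y v) x := fun v ↦
    (h.fun_comp fun A ↦ A v).fderiv_eq
  have h2 : fderiv ℝ (fun y ↦ G y u v) x = fderiv ℝ (fun y ↦ G' y u v) x :=
    (h.fun_comp fun A ↦ A u v).fderiv_eq
  simp only [christoffel, h.eq_of_nhds, h1, h2]

theorem curvature_congr (h : G =ᶠ[𝓝 x] G') (u v w : E) :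
    curvature G x u v w = curvature G' x u v w := by
  have h1 : ∀ v, fderiv ℝ (fun y ↦ christoffel G y v w) x =
      fderiv ℝ (fun y ↦ christoffel G' y v w) x := by
    intro v
    apply EventuallyEq.fderiv_eq
    filter_upwards [h.eventuallyEq_nhds] with y hy using christoffel_congr hy v w
  simp only [curvature, h1, christoffel_congr h]

theorem ricci_congr [FiniteDimensional ℝ E] (h : G =ᶠ[𝓝 x] G') (v w : E) :
    ricci G x v w = ricci G' x v w := by
  simp only [ricci, curvature_congr h]

theorem hessian_congr (h : G =ᶠ[𝓝 x] G') (F : E → ℝ) (u v : E) :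
    hessian G F x u v = hessian G' F x u v := by
  simp only [hessian, christoffel_congr h]

theorem IsMetricAt.congr (hG : IsMetricAt G x) (h : G' =ᶠ[𝓝 x] G) : IsMetricAt G' x where
  contDiffAt := hG.contDiffAt.congr_of_eventuallyEq h
  symm := by
    filter_upwards [hG.symm, h] with y hy he
    rwa [he]
  pos := by
    filter_upwards [hG.pos, h] with y hy he
    rwa [he]

end Congr

section Warped

variable {E : Type*} [NormedAddCommGroup E] [NormedSpace ℝ E] [FiniteDimensional ℝ E]
  {G : E → E →L[ℝ] E →L[ℝ] ℝ} {φ : ℝ → ℝ} {z : ℝ × E}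

theorem trace_real_prod (A : ℝ × E →ₗ[ℝ] ℝ × E) :
    LinearMap.trace ℝ (ℝ × E) A = (A (1, 0)).1
      + LinearMap.trace ℝ E (LinearMap.snd ℝ ℝ E ∘ₗ A ∘ₗ LinearMap.inr ℝ ℝ E) := by
  have h : A = LinearMap.inl ℝ ℝ E ∘ₗ (LinearMap.fst ℝ ℝ E ∘ₗ A)
      + LinearMap.inr ℝ ℝ E ∘ₗ (LinearMap.snd ℝ ℝ E ∘ₗ A) := by
    refine LinearMap.ext fun v ↦ ?_
    simp
  have h1 : LinearMap.trace ℝ ℝ ((LinearMap.fst ℝ ℝ E ∘ₗ A) ∘ₗ LinearMap.inl ℝ ℝ E) =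
      (A (1, 0)).1 := by
    have h2 : (LinearMap.fst ℝ ℝ E ∘ₗ A) ∘ₗ LinearMap.inl ℝ ℝ E = (A (1, 0)).1 • LinearMap.id := by
      refine LinearMap.ext_ring ?_
      simp
    rw [h2, map_smul, LinearMap.trace_id]
    simp
  conv_lhs => rw [h]
  rw [map_add, LinearMap.trace_comp_comm', LinearMap.trace_comp_comm' _ (LinearMap.inr ℝ ℝ E), h1]
  rfl

/-- The Ricci tensor of a warped product. -/
theorem ricci_warped (hφ : ContDiff ℝ ∞ φ) (hφ0 : ∀ t, φ t ≠ 0) (hG : IsMetricAt G z.2)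
    (v w : ℝ × E) :
    ricci (warped φ G) z v w =
      ricci G z.2 v.2 w.2
        - (φ z.1 * deriv (deriv φ) z.1 + (Module.finrank ℝ E - 1) * deriv φ z.1 ^ 2)
          * G z.2 v.2 w.2
        - Module.finrank ℝ E * (deriv (deriv φ) z.1 / φ z.1) * (v.1 * w.1) := by
  have hW := isMetricAt_warped hφ hφ0 hG
  have h : LinearMap.snd ℝ ℝ E ∘ₗ hW.curvatureMap v w ∘ₗ LinearMap.inr ℝ ℝ E =
      hG.curvatureMap v.2 w.2
        - (deriv (deriv φ) z.1 / φ z.1 * w.1 * v.1) • LinearMap.id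
        - deriv φ z.1 ^ 2 • (G z.2 v.2 w.2 • LinearMap.id
          - (G z.2 w.2 : E →ₗ[ℝ] ℝ).smulRight v.2) := by
    refine LinearMap.ext fun u ↦ ?_
    simp only [LinearMap.comp_apply, hW.curvatureMap_apply, curvature_warped hφ hφ0 hG,
      LinearMap.sub_apply, LinearMap.smul_apply, LinearMap.smulRight_apply, LinearMap.id_apply,
      LinearMap.snd_apply, LinearMap.inr_apply, hG.curvatureMap_apply, ContinuousLinearMap.coe_coe,
      hG.symm_self u]
    module
  rw [hW.ricci_eq_trace, hG.ricci_eq_trace, trace_real_prod, h, hW.curvatureMap_apply,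
    curvature_warped hφ hφ0 hG]
  simp only [map_sub, map_smul, LinearMap.trace_smulRight, LinearMap.trace_id, smul_eq_mul,
    ContinuousLinearMap.coe_coe, map_zero, zero_apply]
  rw [hG.symm_self w.2]
  ring

/-- The Hessian of a function of the first variable on a warped product. -/
theorem hessian_warped (hφ : ContDiff ℝ ∞ φ) (hφ0 : ∀ t, φ t ≠ 0) (hG : IsMetricAt G z.2)
    {f : ℝ → ℝ} (hf : ContDiff ℝ ∞ f) (u v : ℝ × E) :
    hessian (warped φ G) (fun y ↦ f y.1) z u v =
      deriv (deriv f) z.1 * (u.1 * v.1)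
        + deriv f z.1 * (φ z.1 * deriv φ z.1) * G z.2 u.2 v.2 := by
  have hd : Differentiable ℝ f := hf.differentiable (by simp)
  have hd' : Differentiable ℝ (deriv f) :=
    ((contDiff_infty_iff_deriv.1 hf).2).differentiable (by simp)
  have h1 : ∀ {k : ℝ → ℝ}, Differentiable ℝ k → ∀ y u : ℝ × E,
      fderiv ℝ (fun y : ℝ × E ↦ k y.1) y u = deriv k y.1 * u.1 := by
    intro k hk y u
    have hfst : HasFDerivAt (fun y : ℝ × E ↦ y.1) (ContinuousLinearMap.fst ℝ ℝ E) y :=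
      hasFDerivAt_fst
    have h : HasFDerivAt (fun y : ℝ × E ↦ k y.1) _ y :=
      (hk y.1).hasDerivAt.comp_hasFDerivAt y hfst
    rw [h.fderiv]
    simp
  have h2 : Differentiable ℝ fun t ↦ deriv f t * v.1 := hd'.mul_const v.1
  simp only [hessian, h1 hd, christoffel_warped hφ hφ0 hG]
  rw [h1 h2, deriv_mul_const (hd' z.1)]
  ring

end Warped

section MetricTrace

variable {E : Type*} [NormedAddCommGroup E] [NormedSpace ℝ E] [FiniteDimensional ℝ E]

theorem metricTrace_add (B₀ B B' : E → E → ℝ) :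
    metricTrace B₀ (fun u v ↦ B u v + B' u v) = metricTrace B₀ B + metricTrace B₀ B' := by
  simp only [metricTrace, mul_add, Finset.sum_add_distrib]

theorem metricTrace_const_mul (B₀ : E → E → ℝ) (c : ℝ) (B : E → E → ℝ) :
    metricTrace B₀ (fun u v ↦ c * B u v) = c * metricTrace B₀ B := by
  simp only [metricTrace, Finset.mul_sum, mul_left_comm]

theorem metricTrace_self (B : E →L[ℝ] E →L[ℝ] ℝ) (hs : ∀ u v, B u v = B v u)
    (hp : ∀ u, u ≠ 0 → 0 < B u u) :
    metricTrace (fun u v ↦ B u v) (fun u v ↦ B u v) = Module.finrank ℝ E := by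
  set b := Module.finBasis ℝ E
  set A : Matrix (Fin (Module.finrank ℝ E)) (Fin (Module.finrank ℝ E)) ℝ :=
    Matrix.of fun k l ↦ B (b k) (b l)
  have hA : IsUnit A := by
    rw [← Matrix.mulVec_injective_iff_isUnit, ← Matrix.coe_mulVecLin, ← LinearMap.ker_eq_bot,
      LinearMap.ker_eq_bot']
    intro c hc
    have h1 : B (∑ i, c i • b i) (∑ i, c i • b i) = 0 := by
      have h2 : ∀ k, B (b k) (∑ i, c i • b i) = 0 := by
        intro k
        have h3 := congrFun hc k
        rw [Matrix.mulVecLin_apply, Matrix.mulVec, dotProduct] at h3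
        simpa [A, mul_comm] using h3
      have h4 : ∀ w, B (∑ i, c i • b i) w = ∑ i, c i * B (b i) w := by
        intro w
        simp
      rw [h4]
      simp only [h2, mul_zero, Finset.sum_const_zero]
    have h5 : ∑ i, c i • b i = 0 := by
      by_contra h6
      exact (hp _ h6).ne' h1
    funext i
    exact Fintype.linearIndependent_iff.1 b.linearIndependent c h5 i
  have h : metricTrace (fun u v ↦ B u v) (fun u v ↦ B u v) = (A⁻¹ * A).trace := by
    simp only [metricTrace, Matrix.trace, Matrix.diag, Matrix.mul_apply]
    refine Finset.sum_congr rfl fun i _ ↦ Finset.sum_congr rfl fun j _ ↦ ?_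
    rw [hs]
    rfl
  rw [h, Matrix.nonsing_inv_mul _ ((Matrix.isUnit_iff_isUnit_det _).1 hA), Matrix.trace_one]
  simp

end MetricTrace

end LocalGeometry

namespace SmoothMetric

open LocalGeometry

section

variable {E : Type*} [NormedAddCommGroup E] [NormedSpace ℝ E]
  {H : Type*} [TopologicalSpace H] {I : ModelWithCorners ℝ E H}
  {M : Type*} [TopologicalSpace M] [ChartedSpace H M] [IsManifold I ∞ M]

theorem mfderivWithin_extChartAt_symm_eq {p : M} {x : E} (hx : x ∈ (extChartAt I p).target) (u : E) :
    mfderivWithin 𝓘(ℝ, E) I (extChartAt I p).symm (Set.range I) x u =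
      (trivializationAt E (TangentSpace I) p).symm ((extChartAt I p).symm x) u := by
  have hs : (extChartAt I p).symm x ∈ (chartAt H p).source := by
    rw [← extChartAt_source I]
    exact (extChartAt I p).map_target hx
  rw [← Bundle.Trivialization.symmL_apply (R := ℝ) _ (by simpa using hs),
    TangentBundle.symmL_trivializationAt hs, (extChartAt I p).right_inv hx]
  rfl

theorem inChart_apply (g : SmoothMetric I M) {p : M} {x : E} (hx : x ∈ (extChartAt I p).target)
    (u v : E) :
    g.inChart p x u v = g.inner ((extChartAt I p).symm x)
      ((trivializationAt E (TangentSpace I) p).symm ((extChartAt I p).symm x) u)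
      ((trivializationAt E (TangentSpace I) p).symm ((extChartAt I p).symm x) v) := by
  rw [← mfderivWithin_extChartAt_symm_eq hx, ← mfderivWithin_extChartAt_symm_eq hx]
  rfl

theorem contDiffAt_inChart [I.Boundaryless] (g : SmoothMetric I M) (p : M) :
    ContDiffAt ℝ ∞ (g.inChart p) (extChartAt I p p) := by
  have h1 := g.contMDiff p
  rw [Bundle.contMDiffAt_section] at h1
  simp only [hom_trivializationAt_apply] at h1
  have h2 : ContMDiffAt 𝓘(ℝ, E) I ∞ (extChartAt I p).symm (extChartAt I p p) :=
    (contMDiffOn_extChartAt_symm p).contMDiffAt (extChartAt_target_mem_nhds p)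
  rw [← extChartAt_to_inv (I := I) p] at h1
  have h3 := (h1.comp _ h2).contDiffAt
  refine h3.congr_of_eventuallyEq ?_
  filter_upwards [extChartAt_target_mem_nhds (I := I) p] with x hx
  have hs : (extChartAt I p).symm x ∈ (chartAt H p).source := by
    rw [← extChartAt_source I]
    exact (extChartAt I p).map_target hx
  refine ContinuousLinearMap.ext fun u ↦ ContinuousLinearMap.ext fun v ↦ ?_
  rw [g.inChart_apply hx]
  simp only [Function.comp_apply, extChartAt_to_inv]
  rw [inCoordinates_apply_eq₂ (by simpa using hs) (by simpa using hs) (Set.mem_univ _)]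
  have e : ∀ r : ℝ, (trivializationAt ℝ (Bundle.Trivial M ℝ) p).linearMapAt ℝ
      ((extChartAt I p).symm x) r = r := by
    intro r; simp
  exact (e _).symm

theorem inChart_pos (g : SmoothMetric I M) {p : M} {x : E} (hx : x ∈ (extChartAt I p).target)
    {u : E} (hu : u ≠ 0) : 0 < g.inChart p x u u := by
  have hs : (extChartAt I p).symm x ∈ (trivializationAt E (TangentSpace I) p).baseSet := by
    have := (extChartAt I p).map_target hx
    simpa using this
  rw [g.inChart_apply hx]
  refine g.pos _ _ fun h ↦ hu ?_
  have h2 := Bundle.Trivialization.continuousLinearMapAt_symmL (R := ℝ) _ hs u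
  rw [Bundle.Trivialization.symmL_apply (R := ℝ) _ hs, h] at h2
  exact h2.symm.trans (ContinuousLinearMap.map_zero _)

theorem inChart_symm (g : SmoothMetric I M) (p : M) (x u v : E) :
    g.inChart p x u v = g.inChart p x v u :=
  g.symm ((extChartAt I p).symm x) _ _

theorem isMetricAt_inChart [I.Boundaryless] (g : SmoothMetric I M) (p : M) :
    IsMetricAt (g.inChart p) (extChartAt I p p) where
  contDiffAt := (g.contDiffAt_inChart p).of_le ENat.LEInfty.out
  symm := .of_forall fun x ↦ g.inChart_symm p x
  pos := by
    filter_upwards [extChartAt_target_mem_nhds (I := I) p] with x hx u hu using g.inChart_pos hx hu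

end

section

variable {E : Type*} [NormedAddCommGroup E] [NormedSpace ℝ E]
  {H : Type*} [TopologicalSpace H] {I : ModelWithCorners ℝ E H}
  {N : Type*} [TopologicalSpace N] [ChartedSpace H N]

theorem extChartAt_real_prod (p : ℝ × N) :
    extChartAt (𝓘(ℝ, ℝ).prod I) p = (PartialEquiv.refl ℝ).prod (extChartAt I p.2) := by
  rw [extChartAt_prod, extChartAt_model_space_eq_id]

variable [I.Boundaryless] [IsManifold I ∞ N] {φ : ℝ → ℝ}

/-- In product charts, a warped product of manifolds is a warped product of open sets. -/
theorem inChart_warpedProduct (hφ : ContDiff ℝ ∞ φ) (hφ0 : ∀ t, φ t ≠ 0) (g : SmoothMetric I N)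
    (p : ℝ × N) :
    (warpedProduct φ hφ hφ0 g).inChart p =ᶠ[𝓝 (extChartAt (𝓘(ℝ, ℝ).prod I) p p)]
      warped φ (g.inChart p.2) := by
  filter_upwards [extChartAt_target_mem_nhds (I := 𝓘(ℝ, ℝ).prod I) p] with z hz
  have hs : (extChartAt (𝓘(ℝ, ℝ).prod I) p).symm z ∈ (chartAt (ModelProd ℝ H) p).source := by
    rw [← extChartAt_source (𝓘(ℝ, ℝ).prod I)]
    exact (extChartAt (𝓘(ℝ, ℝ).prod I) p).map_target hz
  have hz2 : z.2 ∈ (extChartAt I p.2).target := by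
    rw [extChartAt_real_prod] at hz
    exact hz.2
  have e : (extChartAt (𝓘(ℝ, ℝ).prod I) p).symm z = (z.1, (extChartAt I p.2).symm z.2) := by
    rw [extChartAt_real_prod]
    rfl
  refine ContinuousLinearMap.ext fun u ↦ ContinuousLinearMap.ext fun v ↦ ?_
  rw [inChart_apply _ hz, symm_trivializationAt_prod hs, symm_trivializationAt_prod hs,
    warped_apply, g.inChart_apply hz2]
  generalize (extChartAt (𝓘(ℝ, ℝ).prod I) p).symm z = y at e
  subst e
  rfl

variable [FiniteDimensional ℝ E]

/-- The Ricci tensor of a warped product. -/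
theorem ricci_warpedProduct (hφ : ContDiff ℝ ∞ φ) (hφ0 : ∀ t, φ t ≠ 0) (g : SmoothMetric I N)
    (p : ℝ × N) (u v : ℝ × E) :
    (warpedProduct φ hφ hφ0 g).ricci p u v =
      g.ricci p.2 u.2 v.2
        - (φ p.1 * deriv (deriv φ) p.1 + (Module.finrank ℝ E - 1) * deriv φ p.1 ^ 2)
          * g.inner p.2 u.2 v.2
        - Module.finrank ℝ E * (deriv (deriv φ) p.1 / φ p.1) * (u.1 * v.1) := by
  have e : extChartAt (𝓘(ℝ, ℝ).prod I) p p = (p.1, extChartAt I p.2 p.2) := by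
    rw [extChartAt_real_prod]
    rfl
  refine (ricci_congr (inChart_warpedProduct hφ hφ0 g p) u v).trans ?_
  rw [e, ricci_warped hφ hφ0 (z := (p.1, extChartAt I p.2 p.2)) (g.isMetricAt_inChart p.2)]
  simp only [inChart_self]
  rfl

/-- The Hessian of a function of the first variable on a warped product. -/
theorem hessian_warpedProduct (hφ : ContDiff ℝ ∞ φ) (hφ0 : ∀ t, φ t ≠ 0) (g : SmoothMetric I N)
    {f : ℝ → ℝ} (hf : ContDiff ℝ ∞ f) (p : ℝ × N) (u v : ℝ × E) :
    (warpedProduct φ hφ hφ0 g).hessian (fun q ↦ f q.1) p u v =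
      deriv (deriv f) p.1 * (u.1 * v.1)
        + deriv f p.1 * (φ p.1 * deriv φ p.1) * g.inner p.2 u.2 v.2 := by
  have e : extChartAt (𝓘(ℝ, ℝ).prod I) p p = (p.1, extChartAt I p.2 p.2) := by
    rw [extChartAt_real_prod]
    rfl
  have e2 : ∀ y, ((extChartAt (𝓘(ℝ, ℝ).prod I) p).symm y).1 = y.1 := by
    intro y
    rw [extChartAt_real_prod]
    rfl
  refine (hessian_congr (inChart_warpedProduct hφ hφ0 g p) _ u v).trans ?_
  simp only [e2]
  rw [e, hessian_warped hφ hφ0 (z := (p.1, extChartAt I p.2 p.2)) (g.isMetricAt_inChart p.2) hf]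
  simp only [inChart_self]
  rfl

/-- A surface of constant curvature `κ` satisfies `Ric = κ g`. -/
theorem HasConstantCurvature.isEinstein {g : SmoothMetric I N} {κ : ℝ}
    (h : g.HasConstantCurvature κ) : g.IsEinstein (κ * (Module.finrank ℝ E - 1)) := by
  intro p u v
  rw [← g.inChart_self]
  refine (g.isMetricAt_inChart p).ricci_of_constantCurvature ?_ u v
  rw [g.inChart_self]
  exact h p

end

end SmoothMetric

namespace SmoothMetric

open LocalGeometry

section

variable {E : Type*} [NormedAddCommGroup E] [NormedSpace ℝ E] [FiniteDimensional ℝ E]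
  {H : Type*} [TopologicalSpace H] {I : ModelWithCorners ℝ E H}
  {M : Type*} [TopologicalSpace M] [ChartedSpace H M] [IsManifold I ∞ M]

/-- The trace of an equation `Ric + ∇²f = σ g`. -/
theorem scalarCurvature_add_laplacian (g : SmoothMetric I M) (f : M → ℝ) (p : M) {σ : ℝ}
    (h : ∀ u v : TangentSpace I p, g.ricci p u v + g.hessian f p u v = σ * g.inner p u v) :
    g.scalarCurvature p + g.laplacian f p = Module.finrank ℝ E * σ := by
  have h1 := metricTrace_add (E := E) (fun u v ↦ g.inner p u v) (g.ricci p) (g.hessian f p)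
  have h2 : (fun u v : E ↦ g.ricci p u v + g.hessian f p u v) = fun u v ↦ σ * g.inner p u v :=
    funext fun u ↦ funext fun v ↦ h u v
  have h3 := metricTrace_self (E := E) (g.inner p) (g.symm p) (g.pos p)
  have h4 := metricTrace_const_mul (E := E) (fun u v ↦ g.inner p u v) σ (fun u v ↦ g.inner p u v)
  rw [h2] at h1
  exact h1.symm.trans (h4.trans ((congrArg (σ * ·) h3).trans (mul_comm _ _)))

theorem isSteadySoliton_iff_of_finrank_pos (hE : 0 < Module.finrank ℝ E) (g : SmoothMetric I M)
    (f : M → ℝ) :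
    g.IsSteadySoliton f ↔ g.IsHarmonic f ∧ ∀ p, ∃ σ : ℝ, ∀ u v : TangentSpace I p,
      g.ricci p u v + g.hessian f p u v = σ * g.inner p u v := by
  have hE' : (Module.finrank ℝ E : ℝ) ≠ 0 := by exact_mod_cast hE.ne'
  constructor
  · intro h
    have h1 : ∀ (p : M) (u v : TangentSpace I p), g.ricci p u v + g.hessian f p u v =
        1 / (Module.finrank ℝ E : ℝ) * g.scalarCurvature p * g.inner p u v := by
      intro p u v
      have := h p u v
      rw [zero_mul] at this
      linarith
    refine ⟨fun p ↦ ?_, fun p ↦ ⟨_, h1 p⟩⟩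
    have h2 := g.scalarCurvature_add_laplacian f p (h1 p)
    rw [← mul_assoc, mul_one_div_cancel hE', one_mul] at h2
    linarith
  · rintro ⟨hf, h⟩ p u v
    obtain ⟨σ, hσ⟩ := h p
    have h2 := g.scalarCurvature_add_laplacian f p hσ
    rw [hf p, add_zero] at h2
    rw [hσ, h2, ← mul_assoc, one_div_mul_cancel hE', one_mul]
    ring

end

section

variable {E : Type*} [NormedAddCommGroup E] [NormedSpace ℝ E] [FiniteDimensional ℝ E]
  {H : Type*} [TopologicalSpace H] {I : ModelWithCorners ℝ E H}
  {N : Type*} [TopologicalSpace N] [ChartedSpace H N] [IsManifold I ∞ N]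

theorem IsEinstein.unique [Nonempty N] (hE : 0 < Module.finrank ℝ E) {g : SmoothMetric I N}
    {κ κ' : ℝ} (h : g.IsEinstein κ) (h' : g.IsEinstein κ') : κ = κ' := by
  obtain ⟨q⟩ := ‹Nonempty N›
  have : Nontrivial E := Module.nontrivial_of_finrank_pos hE
  obtain ⟨u, hu⟩ := exists_ne (0 : E)
  have h1 := h q u u
  rw [h' q u u] at h1
  exact (mul_right_cancel₀ (g.pos q u hu).ne' h1).symm

variable [I.Boundaryless]

/-- The equation of steady solitons on a warped product. -/
theorem warpedProduct_ricci_add_hessian_iff {φ f : ℝ → ℝ} (hφ : ContDiff ℝ ∞ φ)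
    (hφ0 : ∀ t, φ t ≠ 0) (hf : ContDiff ℝ ∞ f) (g : SmoothMetric I N) (p : ℝ × N) :
    (∃ σ : ℝ, ∀ u v : ℝ × E, (warpedProduct φ hφ hφ0 g).ricci p u v
        + (warpedProduct φ hφ hφ0 g).hessian (fun q ↦ f q.1) p u v
          = σ * (warpedProduct φ hφ hφ0 g).inner p u v) ↔
      ∀ u v : E, g.ricci p.2 u v =
        ((Module.finrank ℝ E - 1) * (deriv φ p.1 ^ 2 - φ p.1 * deriv (deriv φ) p.1)
          + φ p.1 * (deriv (deriv f) p.1 * φ p.1 - deriv f p.1 * deriv φ p.1))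
            * g.inner p.2 u v := by
  have hi : ∀ u v : ℝ × E, (warpedProduct φ hφ hφ0 g).inner p u v =
      u.1 * v.1 + φ p.1 ^ 2 * g.inner p.2 u.2 v.2 := fun _ _ ↦ rfl
  have h0 := hφ0 p.1
  simp only [hi, ricci_warpedProduct, hessian_warpedProduct hφ hφ0 g hf]
  constructor
  · rintro ⟨σ, h⟩ u v
    have h1 := h (1, 0) (1, 0)
    have h2 := h (0, u) (0, v)
    have h3 : g.inner p.2 (0 : E) (0 : E) = 0 := ContinuousLinearMap.map_zero _
    have h4 : g.ricci p.2 (0 : E) (0 : E) = 0 := by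
      have h5 := h 0 0
      simp only [Prod.fst_zero, Prod.snd_zero, h3] at h5
      linarith
    simp only [h3, h4] at h1 h2
    have h6 : σ = deriv (deriv f) p.1
        - Module.finrank ℝ E * (deriv (deriv φ) p.1 / φ p.1) := by linarith
    rw [h6] at h2
    have h7 : φ p.1 ^ 2 * (deriv (deriv φ) p.1 / φ p.1) = φ p.1 * deriv (deriv φ) p.1 := by
      field_simp
    linear_combination h2 - Module.finrank ℝ E * g.inner p.2 u v * h7
  · intro h
    refine ⟨deriv (deriv f) p.1 - Module.finrank ℝ E * (deriv (deriv φ) p.1 / φ p.1),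
      fun u v ↦ ?_⟩
    rw [h]
    field_simp
    ring

/-- A warped product is a steady soliton with potential `f(t)` if and only if `f` is harmonic, the
fibre is Einstein and the warping function satisfies the corresponding equation. -/
theorem warpedProduct_isSteadySoliton_iff [Nonempty N] (hE : 0 < Module.finrank ℝ E) {φ f : ℝ → ℝ}
    (hφ : ContDiff ℝ ∞ φ) (hφ0 : ∀ t, φ t ≠ 0) (hf : ContDiff ℝ ∞ f) (g : SmoothMetric I N) :
    (warpedProduct φ hφ hφ0 g).IsSteadySoliton (fun q ↦ f q.1) ↔
      (warpedProduct φ hφ hφ0 g).IsHarmonic (fun q ↦ f q.1) ∧ ∃ lam : ℝ, g.IsEinstein lam ∧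
        ∀ t, (Module.finrank ℝ E - 1) * (deriv φ t ^ 2 - φ t * deriv (deriv φ) t)
          + φ t * (deriv (deriv f) t * φ t - deriv f t * deriv φ t) = lam := by
  have hE2 : 0 < Module.finrank ℝ (ℝ × E) := by
    rw [Module.finrank_prod]
    omega
  rw [isSteadySoliton_iff_of_finrank_pos hE2]
  refine and_congr_right fun _ ↦ (forall_congr' fun p ↦
    warpedProduct_ricci_add_hessian_iff hφ hφ0 hf g p).trans ⟨fun h ↦ ?_, ?_⟩
  · have hEin : ∀ t, g.IsEinstein
        ((Module.finrank ℝ E - 1) * (deriv φ t ^ 2 - φ t * deriv (deriv φ) t)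
          + φ t * (deriv (deriv f) t * φ t - deriv f t * deriv φ t)) :=
      fun t q u v ↦ h (t, q) u v
    exact ⟨_, hEin 0, fun t ↦ (hEin t).unique hE (hEin 0)⟩
  · rintro ⟨lam, hlam, h⟩ p u v
    rw [h]
    exact hlam p.2 u v

end

end SmoothMetric

theorem warpingEquation_iff {n m : ℕ} (hn : m + 1 = n) (h f : ℝ → ℝ) (lam : ℝ) :
    WarpingEquation n 1 1 h f lam ↔
      ∀ t, ((m : ℝ) - 1) * (deriv (deriv h) t ^ 2 - deriv h t * deriv (deriv (deriv h)) t)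
        + deriv h t * (deriv (deriv f) t * deriv h t - deriv f t * deriv (deriv h) t) = lam := by
  have hm : (n : ℝ) - 2 = m - 1 := by
    rw [← hn]
    push_cast
    ring
  simp only [WarpingEquation, hm, one_mul, mul_one, iteratedDeriv_succ, iteratedDeriv_zero]

theorem mainTheorem3
    {E : Type*} [NormedAddCommGroup E] [NormedSpace ℝ E] [FiniteDimensional ℝ E]
    {N : Type*} [TopologicalSpace N] [ChartedSpace E N] [IsManifold 𝓘(ℝ, E) ∞ N] [Nonempty N]
    (n : ℕ) (hn : Module.finrank ℝ E + 1 = n)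
    (g : SmoothMetric 𝓘(ℝ, E) N)
    (h f : ℝ → ℝ) (hh : ContDiff ℝ ∞ h) (hf : ContDiff ℝ ∞ f) (hh0 : ∀ t, deriv h t ≠ 0) :
    let W : SmoothMetric (𝓘(ℝ, ℝ).prod 𝓘(ℝ, E)) (ℝ × N) :=
      SmoothMetric.warpedProduct (deriv h) (contDiff_infty_iff_deriv.1 hh).2 hh0 g
    let F : ℝ × N → ℝ := fun p ↦ f p.1
    (4 ≤ n →
      (W.IsSteadySoliton F ↔
        W.IsHarmonic F ∧ ∃ lam : ℝ, g.IsEinstein lam ∧ WarpingEquation n 1 1 h f lam)) ∧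
    (n = 3 → ∀ lam : ℝ, g.HasConstantCurvature lam →
      (W.IsSteadySoliton F ↔ W.IsHarmonic F ∧ WarpingEquation n 1 1 h f lam)) := by
  intro W F
  have hiff : 0 < Module.finrank ℝ E → (W.IsSteadySoliton F ↔
      W.IsHarmonic F ∧ ∃ lam : ℝ, g.IsEinstein lam ∧ WarpingEquation n 1 1 h f lam) := by
    intro hE
    simp only [warpingEquation_iff hn]
    exact SmoothMetric.warpedProduct_isSteadySoliton_iff hE _ hh0 hf g
  refine ⟨fun h4 ↦ hiff (by omega), fun h3 lam hlam ↦ ?_⟩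
  have hE : Module.finrank ℝ E = 2 := by omega
  have hlam' : g.IsEinstein lam := by
    have := hlam.isEinstein
    rw [hE] at this
    norm_num at this
    exact this
  rw [hiff (by omega)]
  refine and_congr_right fun _ ↦ ⟨?_, fun hw ↦ ⟨lam, hlam', hw⟩⟩
  rintro ⟨lam', he, hw⟩
  rwa [hlam'.unique (by omega) he]
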